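/- Let $(\mathcal H_i)_{i\in I}$ be a family of complex Hilbert spaces, each of dimension $d_i\in\mathbb N_{>1}\cup\{\infty\}$, with unit vectors $|0_i\rangle\in\mathcal H_i$, and let $\mathcal H=\bigotimes_{i\in I}\mathcal H_i$ be their Hilbert tensor product. (If $I$ is finite this is the usual completed tensor product and does not depend on the $|0_i\rangle$; if $I$ is infinite it is von Neumann's incomplete tensor product with reference vector $\bigotimes_i|0_i\rangle$.) For $i\in I$ write $\mathcal H=\mathcal H_i\otimes\mathcal H_{\bar i}$ with $\mathcal H_{\bar i}=\bigotimes_{j\ne i}\mathcal H_j$. Let $G=(G_k)_{k\in K}$ be a generating family for $\mathcal H_i$: the $G_k$ are closed, densely defined (possibly unbounded) operators on $\mathcal H_i$ such that the bounded operators obtained from them by taking adjoints, products, linear combinations and closures are dense, in the weak operator topology, in the algebra of all bounded operators on $\mathcal H_i$. (If $d_i<\infty$ this says that adjoints, products and linear combinations of the $G_k$ give every operator on $\mathcal H_i$.) For a unitary $U$ on $\mathcal H$ let $$[U]^{i}=\{(\mathbb 1\otimes W)\,U : W \text{ a unitary operator on } \mathcal H_{\bar i}\},$$ and let the time-evolved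 descriptor be the family $q_i^U=\bigl(U^\dagger(G_k\otimes\mathbb 1)U\bigr)_{k\in K}$, where $G_k\otimes\mathbb 1$ is the closed operator on $\mathcal H_i\otimes\mathcal H_{\bar i}$ acting by $x\otimes y\mapsto G_kx\otimes y$. Then for every $i\in I$, every generating family $G$ for $\mathcal H_i$, and all unitaries $U,U'$ on $\mathcal H$, $$[U]^{i}=[U']^{i}\iff q_i^{U}=q_i^{U'},$$ that is, $U^\dagger(G_k\otimes\mathbb 1)U=U'^\dagger(G_k\otimes\mathbb 1)U'$ for every $k\in K$. -/

import Mathlib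

open scoped TensorProduct InnerProductSpace ComplexOrder LinearPMap
open UniformSpace (Completion)

noncomputable section

namespace QDescriptor

universe u v w

/-! ### The Hilbert tensor product of a family of Hilbert spaces

For a family `H i` of Hilbert spaces with reference unit vectors `Ω i`, product vectors are the
families `x` with `x i = Ω i` for all but finitely many `i`.  The tensor product is the Hilbert
space generated by the product vectors with inner product `∏ i, ⟪x i, y i⟫`.  For a finite index
type every family is a product vector, and this is the usual Hilbert tensor product; for an
infinite index type it is von Neumann's (incomplete) infinite tensor product. -/

section Tensor

variable {I : Type u} {H : I → Type v} [∀ i, NormedAddCommGroup (H i)]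
  [∀ i, InnerProductSpace ℂ (H i)]

/-- Families of vectors that agree with the reference family up to finitely many factors. -/
def ProdVec (Ω : ∀ i, Metric.sphere (0 : H i) 1) : Type (max u v) :=
  {x : ∀ i, H i // {i | x i ≠ (Ω i : H i)}.Finite}

variable (Ω : ∀ i, Metric.sphere (0 : H i) 1)

/-- The inner product of two product vectors; all but finitely many factors are `1`. -/
def kernel (x y : ProdVec Ω) : ℂ := ∏ᶠ i, ⟪x.1 i, y.1 i⟫_ℂ

variable {Ω} in
theorem kernel_eq_prod (x y : ProdVec Ω) (T : Finset I)
    (hx : ∀ i, x.1 i ≠ (Ω i : H i) → i ∈ T) (hy : ∀ i, y.1 i ≠ (Ω i : H i) → i ∈ T) :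
    kernel Ω x y = ∏ i ∈ T, ⟪x.1 i, y.1 i⟫_ℂ := by
  refine finprod_eq_prod_of_mulSupport_subset _ fun i hi => ?_
  by_contra hT
  have h1 : x.1 i = Ω i := by by_contra h; exact hT (hx i h)
  have h2 : y.1 i = Ω i := by by_contra h; exact hT (hy i h)
  refine hi ?_
  have h3 : ‖(Ω i : H i)‖ = 1 := norm_eq_of_mem_sphere (Ω i)
  simp only [h1, h2, inner_self_eq_norm_sq_to_K, h3]
  simp

theorem posSemidef_gram {X E : Type*} [NormedAddCommGroup E] [InnerProductSpace ℂ E] (v : X → E) :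
    (Matrix.of fun x y => ⟪v x, v y⟫_ℂ).PosSemidef := by
  refine ⟨by ext x y; simp, fun f => ?_⟩
  have h : (f.sum fun x a => f.sum fun y b => star a * ⟪v x, v y⟫_ℂ * b) =
      ⟪f.sum fun x a => a • v x, f.sum fun x a => a • v x⟫_ℂ := by
    simp only [Finsupp.sum, sum_inner, inner_sum, inner_smul_left, inner_smul_right]
    simp only [Finset.mul_sum]
    rw [Finset.sum_comm]
    refine Finset.sum_congr rfl fun x _ => Finset.sum_congr rfl fun y _ => ?_
    simp
    ring
  simp only [Matrix.of_apply]
  rw [h, inner_self_eq_norm_sq_to_K]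
  norm_cast
  positivity

theorem posSemidef_kernel : (Matrix.of (kernel Ω)).PosSemidef := by
  classical
  have key : ∀ T : Finset I,
      (Matrix.of fun x y : ProdVec Ω => ∏ i ∈ T, ⟪x.1 i, y.1 i⟫_ℂ).PosSemidef := by
    intro T
    induction T using Finset.induction_on with
    | empty => simpa using posSemidef_gram (fun _ : ProdVec Ω => (1 : ℂ))
    | insert i T hi ih =>
      have := (posSemidef_gram (fun x : ProdVec Ω => x.1 i)).hadamard ih
      simp only [Finset.prod_insert hi]
      exact this
  refine ⟨?_, fun f => ?_⟩
  · ext x y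
    simp only [Matrix.conjTranspose_apply, Matrix.of_apply]
    have hT := kernel_eq_prod y x (y.2.toFinset ∪ x.2.toFinset)
      (fun i hi => by simp [hi]) (fun i hi => by simp [hi])
    have hT' := kernel_eq_prod x y (y.2.toFinset ∪ x.2.toFinset)
      (fun i hi => by simp [hi]) (fun i hi => by simp [hi])
    simp [hT, hT']
  · let T : Finset I := f.support.biUnion fun x => x.2.toFinset
    have hT : ∀ x ∈ f.support, ∀ i, x.1 i ≠ (Ω i : H i) → i ∈ T := fun x hx i hi =>
      Finset.mem_biUnion.2 ⟨x, hx, by simpa using hi⟩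
    have := (key T).2 f
    refine this.trans_eq ?_
    refine Finset.sum_congr rfl fun x hx => Finset.sum_congr rfl fun y hy => ?_
    simp only [Matrix.of_apply]
    rw [kernel_eq_prod x y T (hT x hx) (hT y hy)]

/-- Finite formal linear combinations of product vectors. -/
abbrev PreTensor : Type (max u v) := ProdVec Ω →₀ ℂ

instance : PreInnerProductSpace.Core ℂ (PreTensor Ω) where
  inner f g := f.sum fun x a => g.sum fun y b => star a * kernel Ω x y * b
  conj_inner_symm f g := by
    rw [Finsupp.sum_comm]
    simp only [map_finsuppSum]
    refine Finset.sum_congr rfl fun x _ => Finset.sum_congr rfl fun y _ => ?_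
    have := (posSemidef_kernel Ω).isHermitian.apply x y
    simp only [Matrix.of_apply] at this
    dsimp only
    rw [← this]
    simp
    ring
  add_left f g h := by
    refine Finsupp.sum_add_index' (f := f) (g := g) ?_ ?_
    · simp
    · intro x a b
      rw [← Finsupp.sum_add]
      simp [add_mul]
  smul_left f g c := by
    refine (Finsupp.sum_smul_index (g := f) (b := c) ?_).trans ?_
    · simp
    · simp [Finsupp.mul_sum, mul_assoc]
  re_inner_nonneg f := (RCLike.nonneg_iff.1 ((posSemidef_kernel Ω).2 f)).1

instance : SeminormedAddCommGroup (PreTensor Ω) :=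
  InnerProductSpace.Core.toSeminormedAddCommGroup (𝕜 := ℂ)

instance : InnerProductSpace ℂ (PreTensor Ω) := .ofCore _

/-- The Hilbert space `⨂ i, H i` (relative to the reference unit vectors `Ω i`). -/
abbrev Tensor : Type (max u v) := Completion (PreTensor Ω)

/-- The product vector `⨂ i, x i`. -/
def tprod (x : ProdVec Ω) : Tensor Ω :=
  ((Finsupp.single x 1 : PreTensor Ω) : Tensor Ω)

theorem inner_tprod (x y : ProdVec Ω) : ⟪tprod Ω x, tprod Ω y⟫_ℂ = kernel Ω x y := by
  rw [tprod, tprod, UniformSpace.Completion.inner_coe]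
  change Finsupp.sum _ _ = _
  simp

theorem span_tprod_dense : Dense (Submodule.span ℂ (Set.range (tprod Ω)) : Set (Tensor Ω)) := by
  have h : Set.range ((↑) : PreTensor Ω → Tensor Ω) ⊆
      (Submodule.span ℂ (Set.range (tprod Ω)) : Set (Tensor Ω)) := by
    rintro _ ⟨f, rfl⟩
    induction f using Finsupp.induction_linear with
    | zero => exact Submodule.zero_mem _
    | add f g hf hg =>
      have : ((f + g : PreTensor Ω) : Tensor Ω) = (f : Tensor Ω) + (g : Tensor Ω) :=
        UniformSpace.Completion.coe_add (α := PreTensor Ω) f g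
      rw [this]
      exact Submodule.add_mem _ hf hg
    | single x a =>
      have h1 : (Finsupp.single x a : PreTensor Ω) = a • (Finsupp.single x 1 : PreTensor Ω) := by
        simp
      have : ((Finsupp.single x a : PreTensor Ω) : Tensor Ω) = a • tprod Ω x := by
        rw [h1, tprod]
        exact UniformSpace.Completion.coe_smul (X := PreTensor Ω) a _
      rw [this]
      exact Submodule.smul_mem _ _ (Submodule.subset_span ⟨x, rfl⟩)
  exact (UniformSpace.Completion.denseRange_coe (α := PreTensor Ω)).mono h

end Tensor

/-! ### Bipartite Hilbert tensor products and operators on them -/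

section Bipartite

variable (E : Type v) (F : Type w) [NormedAddCommGroup E] [InnerProductSpace ℂ E]
  [NormedAddCommGroup F] [InnerProductSpace ℂ F]

/-- The Hilbert tensor product of two Hilbert spaces: the completion of the algebraic one. -/
abbrev HTensor : Type (max v w) := Completion (E ⊗[ℂ] F)

variable {E F}

/-- The unitary `1 ⊗ W` on the Hilbert tensor product. -/
def idTensor (W : F ≃ₗᵢ[ℂ] F) : HTensor E F ≃ₗᵢ[ℂ] HTensor E F where
  toFun := ((W.lTensor E : E ⊗[ℂ] F ≃ₗᵢ[ℂ] E ⊗[ℂ] F) : E ⊗[ℂ] F →L[ℂ] E ⊗[ℂ] F).completion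
  invFun := ((W.symm.lTensor E : E ⊗[ℂ] F ≃ₗᵢ[ℂ] E ⊗[ℂ] F) :
    E ⊗[ℂ] F →L[ℂ] E ⊗[ℂ] F).completion
  map_add' := map_add _
  map_smul' := map_smul _
  left_inv x := by
    induction x using UniformSpace.Completion.induction_on with
    | hp => exact isClosed_eq (by fun_prop) (by fun_prop)
    | ih x =>
      simp only [ContinuousLinearMap.completion_apply_coe]
      congr 1
      exact (W.lTensor E).symm_apply_apply x
  right_inv x := by
    induction x using UniformSpace.Completion.induction_on with
    | hp => exact isClosed_eq (by fun_prop) (by fun_prop)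
    | ih x =>
      simp only [ContinuousLinearMap.completion_apply_coe]
      congr 1
      exact (W.lTensor E).apply_symm_apply x
  norm_map' x := by
    induction x using UniformSpace.Completion.induction_on with
    | hp => exact isClosed_eq (ContinuousLinearMap.continuous _).norm continuous_norm
    | ih x =>
      change ‖ContinuousLinearMap.completion _ _‖ = _
      rw [ContinuousLinearMap.completion_apply_coe, UniformSpace.Completion.norm_coe,
        UniformSpace.Completion.norm_coe]
      exact (W.lTensor E).norm_map x

theorem idTensor_tmul (W : F ≃ₗᵢ[ℂ] F) (x : E) (y : F) :
    idTensor W ((x ⊗ₜ[ℂ] y : E ⊗[ℂ] F) : HTensor E F) =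
      ((x ⊗ₜ[ℂ] W y : E ⊗[ℂ] F) : HTensor E F) := by
  change ContinuousLinearMap.completion _ _ = _
  rw [ContinuousLinearMap.completion_apply_coe]
  simp

/-- The graph of `T ⊗ 1` on the Hilbert tensor product: the closed subspace spanned by the pairs
`(x ⊗ y, T x ⊗ y)` with `x` in the domain of `T`. -/
def tensorIdGraph (F : Type w) [NormedAddCommGroup F] [InnerProductSpace ℂ F]
    (T : E →ₗ.[ℂ] E) : Submodule ℂ (HTensor E F × HTensor E F) :=
  (Submodule.span ℂ {p | ∃ (x : T.domain) (y : F),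
    p = ((((x : E) ⊗ₜ[ℂ] y : E ⊗[ℂ] F) : HTensor E F),
      ((T x ⊗ₜ[ℂ] y : E ⊗[ℂ] F) : HTensor E F))}).topologicalClosure

/-- The operator `T ⊗ 1` on the Hilbert tensor product, for a closed operator `T`. -/
def tensorId (F : Type w) [NormedAddCommGroup F] [InnerProductSpace ℂ F]
    (T : E →ₗ.[ℂ] E) : HTensor E F →ₗ.[ℂ] HTensor E F :=
  (tensorIdGraph F T).toLinearPMap

/-- The partial inner product `x ⊗ y ↦ ⟪v, y⟫ x`. -/
def slice [CompleteSpace E] (v : F) : HTensor E F →L[ℂ] E :=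
  ContinuousLinearMap.fromCompletion
    ((TensorProduct.ridIsometry ℂ E : E ⊗[ℂ] ℂ →L[ℂ] E).comp
      (ContinuousLinearMap.lTensor E (innerSL ℂ v)))

theorem slice_tmul [CompleteSpace E] (v : F) (x : E) (y : F) :
    slice v ((x ⊗ₜ[ℂ] y : E ⊗[ℂ] F) : HTensor E F) = ⟪v, y⟫_ℂ • x := by
  rw [slice, ContinuousLinearMap.fromCompletion_apply_coe]
  simp

theorem inner_slice [CompleteSpace E] (v : F) (x : E) (z : HTensor E F) :
    ⟪x, slice v z⟫_ℂ = ⟪((x ⊗ₜ[ℂ] v : E ⊗[ℂ] F) : HTensor E F), z⟫_ℂ := by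
  induction z using UniformSpace.Completion.induction_on with
  | hp => exact isClosed_eq (by fun_prop) (by fun_prop)
  | ih z =>
    induction z using TensorProduct.induction_on with
    | zero => rw [UniformSpace.Completion.coe_zero, map_zero, inner_zero_right, inner_zero_right]
    | tmul a c =>
      rw [slice_tmul, UniformSpace.Completion.inner_coe, TensorProduct.inner_tmul,
        inner_smul_right, mul_comm]
    | add z w hz hw =>
      rw [UniformSpace.Completion.coe_add, map_add, inner_add_right, inner_add_right, hz, hw]

theorem eq_zero_of_slice [CompleteSpace E] (z : HTensor E F) (h : ∀ v : F, slice v z = 0) :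
    z = 0 := by
  refine UniformSpace.Completion.denseRange_coe.eq_zero_of_inner_right ℂ fun w => ?_
  induction w using TensorProduct.induction_on with
  | zero => rw [UniformSpace.Completion.coe_zero, inner_zero_left]
  | tmul a c => rw [← inner_slice, h, inner_zero_right]
  | add w w' hw hw' =>
    rw [UniformSpace.Completion.coe_add, inner_add_left, hw, hw', add_zero]

theorem slice_mem_graph [CompleteSpace E] {T : E →ₗ.[ℂ] E} (hT : T.IsClosed) (v : F)
    (p : HTensor E F × HTensor E F) (hp : p ∈ tensorIdGraph F T) :
    (slice v p.1, slice v p.2) ∈ T.graph := by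
  let L : HTensor E F × HTensor E F →L[ℂ] E × E := (slice v).prodMap (slice v)
  have hc : IsClosed {p | L p ∈ T.graph} := hT.preimage L.continuous
  refine closure_minimal ?_ hc hp
  change Submodule.span ℂ _ ≤ T.graph.comap (L : HTensor E F × HTensor E F →ₗ[ℂ] E × E)
  rw [Submodule.span_le]
  rintro _ ⟨x, y, rfl⟩
  change (slice v (((x : E) ⊗ₜ[ℂ] y : E ⊗[ℂ] F) : HTensor E F),
    slice v ((T x ⊗ₜ[ℂ] y : E ⊗[ℂ] F) : HTensor E F)) ∈ T.graph
  rw [slice_tmul, slice_tmul]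
  exact T.graph.smul_mem ⟪v, y⟫_ℂ (T.mem_graph x)

/-- For a closed operator `T`, `tensorIdGraph` is the graph of an operator, namely `tensorId`. -/
theorem graph_tensorId [CompleteSpace E] {T : E →ₗ.[ℂ] E} (hT : T.IsClosed) :
    (tensorId F T).graph = tensorIdGraph F T := by
  refine Submodule.toLinearPMap_graph_eq _ fun p hp h0 => eq_zero_of_slice _ fun v => ?_
  refine T.graph_fst_eq_zero_snd (slice_mem_graph hT v p hp) ?_
  rw [h0, map_zero]

end Bipartite

/-! ### Partially defined operators and generating sets -/

section Operators

variable {X : Type u} {Y : Type v} [NormedAddCommGroup X] [InnerProductSpace ℂ X]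
  [NormedAddCommGroup Y] [InnerProductSpace ℂ Y]

/-- The operator `U† T U`, with domain `{x | U x ∈ dom T}`. -/
def conjBy (U : X ≃ₗᵢ[ℂ] Y) (T : Y →ₗ.[ℂ] Y) : X →ₗ.[ℂ] X where
  domain := T.domain.comap (U.toLinearEquiv : X →ₗ[ℂ] Y)
  toFun := (U.symm.toLinearEquiv : Y →ₗ[ℂ] X) ∘ₗ T.toFun ∘ₗ
    ((U.toLinearEquiv : X →ₗ[ℂ] Y).restrict fun _ hx => hx)

theorem conjBy_apply (U : X ≃ₗᵢ[ℂ] Y) (T : Y →ₗ.[ℂ] Y) (x : (conjBy U T).domain) :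
    conjBy U T x = U.symm (T ⟨U x, x.2⟩) := rfl

/-- The product `S T` of partially defined operators, with domain `{x ∈ dom T | T x ∈ dom S}`. -/
def opMul (S T : X →ₗ.[ℂ] X) : X →ₗ.[ℂ] X :=
  S.comp (T.domRestrict ((S.domain.comap T.toFun).map T.domain.subtype)) (by
    rintro ⟨_, ⟨x, hx, rfl⟩, hx'⟩
    have : T.domRestrict ((S.domain.comap T.toFun).map T.domain.subtype)
        ⟨_, ⟨x, hx, rfl⟩, hx'⟩ = T x := LinearPMap.domRestrict_apply rfl
    rw [this]
    exact hx)

theorem mem_opMul_domain (S T : X →ₗ.[ℂ] X) (x : X) :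
    x ∈ (opMul S T).domain ↔ ∃ h : x ∈ T.domain, T ⟨x, h⟩ ∈ S.domain := by
  constructor
  · rintro ⟨⟨x, hx, rfl⟩, hx'⟩
    exact ⟨x.2, hx⟩
  · rintro ⟨h, h'⟩
    exact ⟨⟨⟨x, h⟩, h', rfl⟩, h⟩

theorem opMul_apply (S T : X →ₗ.[ℂ] X) (x : X) (h : x ∈ T.domain) (h' : T ⟨x, h⟩ ∈ S.domain) :
    opMul S T ⟨x, (mem_opMul_domain S T x).2 ⟨h, h'⟩⟩ = S ⟨T ⟨x, h⟩, h'⟩ := rfl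

variable [CompleteSpace X] {κ : Type w}

/-- The operators obtained from the family `G` by taking adjoints, products, linear combinations
and closures. -/
inductive Generated (G : κ → X →ₗ.[ℂ] X) : (X →ₗ.[ℂ] X) → Prop
  | of (k : κ) : Generated G (G k)
  | adjoint (T : X →ₗ.[ℂ] X) (hT : Dense (T.domain : Set X)) :
      Generated G T → Generated G T†
  | mul (S T : X →ₗ.[ℂ] X) : Generated G S → Generated G T → Generated G (opMul S T)
  | add (S T : X →ₗ.[ℂ] X) : Generated G S → Generated G T → Generated G (S + T)
  | smul (c : ℂ) (T : X →ₗ.[ℂ] X) : Generated G T → Generated G (c • T)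
  | closure (T : X →ₗ.[ℂ] X) (hT : T.IsClosable) : Generated G T → Generated G T.closure

/-- `G` is a generating family of (closed, densely defined, possibly unbounded) operators: the
bounded operators that it generates span the whole operator algebra, i.e. they are dense in all
bounded operators for the weak operator topology.  (In finite dimension: they are all operators.)
-/
structure IsGenerating (G : κ → X →ₗ.[ℂ] X) : Prop where
  dense_domain (k : κ) : Dense ((G k).domain : Set X)
  isClosed (k : κ) : (G k).IsClosed
  dense_span : Dense {B : X →WOT[ℂ] X |
    Generated G ((B.toCLM : X →ₗ[ℂ] X).toPMap ⊤)}

end Operators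

/-! ### Subsystems -/

section System

variable {I : Type u} {H : I → Type v} [∀ i, NormedAddCommGroup (H i)]
  [∀ i, InnerProductSpace ℂ (H i)]

/-- The Hilbert space `⨂ j ≠ i, H j` of the complement of subsystem `i`. -/
abbrev Compl (Ω : ∀ i, Metric.sphere (0 : H i) 1) (i : I) : Type (max u v) :=
  Tensor fun j : {j // j ≠ i} => Ω j

variable (Ω : ∀ i, Metric.sphere (0 : H i) 1) (i : I)

/-- Forget the `i`-th factor of a product vector. -/
def ProdVec.erase (x : ProdVec Ω) : ProdVec fun j : {j // j ≠ i} => Ω j :=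
  ⟨fun j => x.1 j, x.2.preimage Subtype.val_injective.injOn⟩

open Classical in
/-- Insert the `i`-th factor into a product vector of the other factors. -/
def ProdVec.insert (a : H i) (y : ProdVec fun j : {j // j ≠ i} => Ω j) : ProdVec Ω :=
  ⟨fun j => if h : j = i then h ▸ a else y.1 ⟨j, h⟩, by
    refine ((y.2.image Subtype.val).insert i).subset fun j hj => ?_
    by_cases h : j = i
    · exact Or.inl h
    · exact Or.inr ⟨⟨j, h⟩, by simpa [h] using hj, rfl⟩⟩

set_option linter.unusedSectionVars false in
theorem insert_same (a : H i) (y : ProdVec fun j : {j // j ≠ i} => Ω j) :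
    (ProdVec.insert Ω i a y).1 i = a := by
  simp [ProdVec.insert]

set_option linter.unusedSectionVars false in
theorem erase_insert (a : H i) (y : ProdVec fun j : {j // j ≠ i} => Ω j) :
    ProdVec.erase Ω i (ProdVec.insert Ω i a y) = y := by
  refine Subtype.ext (funext fun j => ?_)
  simp [ProdVec.insert, ProdVec.erase, j.2]

theorem kernel_erase (x y : ProdVec Ω) :
    kernel Ω x y = ⟪x.1 i, y.1 i⟫_ℂ *
      kernel (fun j : {j // j ≠ i} => Ω j) (ProdVec.erase Ω i x) (ProdVec.erase Ω i y) := by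
  classical
  let T : Finset I := insert i (x.2.toFinset ∪ y.2.toFinset)
  have hx : ∀ j, x.1 j ≠ (Ω j : H j) → j ∈ T := fun j hj => by simp [T, hj]
  have hy : ∀ j, y.1 j ≠ (Ω j : H j) → j ∈ T := fun j hj => by simp [T, hj]
  rw [kernel_eq_prod x y T hx hy,
    kernel_eq_prod (ProdVec.erase Ω i x) (ProdVec.erase Ω i y) (T.subtype (· ≠ i))
      (fun j hj => by simpa using hx j hj) (fun j hj => by simpa using hy j hj),
    ← Finset.mul_prod_erase T _ (show i ∈ T by simp [T])]
  congr 1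
  have : T.erase i = (T.subtype (· ≠ i)).map (Function.Embedding.subtype _) := by
    ext j
    simp [and_comm]
  rw [this, Finset.prod_map]
  rfl

/-- The map `⨂ j, x j ↦ x i ⊗ (⨂ j ≠ i, x j)` on formal combinations of product vectors. -/
def preSplit : PreTensor Ω →ₗᵢ[ℂ] HTensor (H i) (Compl Ω i) :=
  LinearMap.isometryOfInner
    (Finsupp.linearCombination ℂ fun x : ProdVec Ω =>
      ((x.1 i ⊗ₜ[ℂ] tprod _ (ProdVec.erase Ω i x) : H i ⊗[ℂ] Compl Ω i) :
        HTensor (H i) (Compl Ω i))) (by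
    intro f g
    simp only [Finsupp.linearCombination_apply, Finsupp.sum, sum_inner, inner_sum,
      inner_smul_left, inner_smul_right, UniformSpace.Completion.inner_coe,
      TensorProduct.inner_tmul, inner_tprod, ← kernel_erase]
    change _ = f.sum fun x a => g.sum fun y b => star a * kernel Ω x y * b
    simp only [Finsupp.sum]
    simp only [Finset.mul_sum]
    rw [Finset.sum_comm]
    refine Finset.sum_congr rfl fun x _ => Finset.sum_congr rfl fun y _ => ?_
    simp
    ring)

theorem preSplit_single (x : ProdVec Ω) :
    preSplit Ω i (Finsupp.single x 1) =
      ((x.1 i ⊗ₜ[ℂ] tprod _ (ProdVec.erase Ω i x) : H i ⊗[ℂ] Compl Ω i) :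
        HTensor (H i) (Compl Ω i)) := by
  change Finsupp.linearCombination ℂ _ _ = _
  simp

/-- The extension of `preSplit` by continuity. -/
def splitIsometry : Tensor Ω →ₗᵢ[ℂ] HTensor (H i) (Compl Ω i) where
  toLinearMap := ((preSplit Ω i).toContinuousLinearMap.fromCompletion :
    Tensor Ω →L[ℂ] HTensor (H i) (Compl Ω i))
  norm_map' x := by
    induction x using UniformSpace.Completion.induction_on with
    | hp => exact isClosed_eq (ContinuousLinearMap.continuous _).norm continuous_norm
    | ih x =>
      change ‖ContinuousLinearMap.fromCompletion _ _‖ = _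
      rw [ContinuousLinearMap.fromCompletion_apply_coe, UniformSpace.Completion.norm_coe]
      exact (preSplit Ω i).norm_map x

theorem splitIsometry_tprod (x : ProdVec Ω) :
    splitIsometry Ω i (tprod Ω x) =
      ((x.1 i ⊗ₜ[ℂ] tprod _ (ProdVec.erase Ω i x) : H i ⊗[ℂ] Compl Ω i) :
        HTensor (H i) (Compl Ω i)) := by
  change ContinuousLinearMap.fromCompletion _ _ = _
  rw [tprod, ContinuousLinearMap.fromCompletion_apply_coe]
  exact preSplit_single Ω i x

theorem splitIsometry_surjective : Function.Surjective (splitIsometry Ω i) := by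
  let R : Submodule ℂ (HTensor (H i) (Compl Ω i)) :=
    LinearMap.range (splitIsometry Ω i).toLinearMap
  have hR : IsClosed (R : Set (HTensor (H i) (Compl Ω i))) := by
    exact (splitIsometry Ω i).isometry.isClosedEmbedding.isClosed_range
  have h1 : ∀ (a : H i) (c : Compl Ω i),
      ((a ⊗ₜ[ℂ] c : H i ⊗[ℂ] Compl Ω i) : HTensor (H i) (Compl Ω i)) ∈ R := by
    intro a
    let L : Compl Ω i →L[ℂ] HTensor (H i) (Compl Ω i) :=
      (UniformSpace.Completion.toComplL (𝕜 := ℂ) (E := H i ⊗[ℂ] Compl Ω i)).comp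
        (TensorProduct.mkL ℂ (H i) (Compl Ω i) a)
    have hc : IsClosed {c | L c ∈ R} := hR.preimage L.continuous
    have hs : (Submodule.span ℂ (Set.range (tprod fun j : {j // j ≠ i} => Ω j)) :
        Set (Compl Ω i)) ⊆ {c | L c ∈ R} := by
      change Submodule.span ℂ _ ≤ R.comap (L : Compl Ω i →ₗ[ℂ] HTensor (H i) (Compl Ω i))
      rw [Submodule.span_le]
      rintro _ ⟨y, rfl⟩
      refine ⟨tprod Ω (ProdVec.insert Ω i a y), ?_⟩
      refine (splitIsometry_tprod Ω i _).trans ?_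
      rw [insert_same, erase_insert]
      rfl
    intro c
    have := (span_tprod_dense fun j : {j // j ≠ i} => Ω j).closure_eq ▸ Set.mem_univ c
    exact (closure_minimal hs hc) this
  intro z
  change z ∈ R
  induction z using UniformSpace.Completion.induction_on with
  | hp => exact hR
  | ih z =>
    induction z using TensorProduct.induction_on with
    | zero => exact R.zero_mem
    | tmul a c => exact h1 a c
    | add z w hz hw =>
      rw [UniformSpace.Completion.coe_add]
      exact R.add_mem hz hw

/-- The canonical unitary `⨂ j, H j ≃ H i ⊗ (⨂ j ≠ i, H j)`. -/
def split : Tensor Ω ≃ₗᵢ[ℂ] HTensor (H i) (Compl Ω i) :=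
  LinearIsometryEquiv.ofSurjective (splitIsometry Ω i) (splitIsometry_surjective Ω i)

theorem split_tprod (x : ProdVec Ω) :
    split Ω i (tprod Ω x) =
      ((x.1 i ⊗ₜ[ℂ] tprod _ (ProdVec.erase Ω i x) : H i ⊗[ℂ] Compl Ω i) :
        HTensor (H i) (Compl Ω i)) :=
  splitIsometry_tprod Ω i x

/-- The unitary `1 ⊗ W` on the whole space, for `W` acting on the complement of subsystem `i`. -/
def complAct (W : Compl Ω i ≃ₗᵢ[ℂ] Compl Ω i) : Tensor Ω ≃ₗᵢ[ℂ] Tensor Ω :=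
  ((split Ω i).trans (idTensor W)).trans (split Ω i).symm

/-- The noumenal state `[U]` of subsystem `i`: all `(1 ⊗ W) U` with `W` a unitary on the
complement. -/
def noumenal (U : Tensor Ω ≃ₗᵢ[ℂ] Tensor Ω) : Set (Tensor Ω ≃ₗᵢ[ℂ] Tensor Ω) :=
  {U' | ∃ W : Compl Ω i ≃ₗᵢ[ℂ] Compl Ω i, U' = complAct Ω i W * U}

variable {κ : Type w}

/-- The descriptor `G ⊗ 1` of subsystem `i` at time `0`, one component for each generator. -/
def descriptorZero (G : κ → H i →ₗ.[ℂ] H i) (k : κ) : Tensor Ω →ₗ.[ℂ] Tensor Ω :=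
  conjBy (split Ω i) (tensorId (Compl Ω i) (G k))

/-- The time-evolved descriptor `U† (G ⊗ 1) U` of subsystem `i`. -/
def descriptor (G : κ → H i →ₗ.[ℂ] H i) (U : Tensor Ω ≃ₗᵢ[ℂ] Tensor Ω) (k : κ) :
    Tensor Ω →ₗ.[ℂ] Tensor Ω :=
  conjBy U (descriptorZero Ω i G k)

end System

end QDescriptor
end

open scoped TensorProduct InnerProductSpace LinearPMap
open UniformSpace (Completion)

/-! The class of `U` is its orbit under the group of all `1 ⊗ W`, and the descriptors of `U` and
`U'` agree iff `V = U U'†`, transported to `H i ⊗ Compl Ω i`, maps the graph of each `G k ⊗ 1` onto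
itself. So the theorem says that the unitaries commuting with every `G k ⊗ 1` are exactly the `1 ⊗
W`.

That `1 ⊗ W` commutes is seen on the spanning pairs of the graph. For the converse, slice `V` into
its coefficients `⟨v|V|w⟩`, bounded operators on `H i`. Each of them, and its adjoint `⟨w|V†|v⟩`,
preserves the graphs of the closed operators `G k` (`coeff_preservesGraph`), hence of everything
generated from them (`Generated.preservesGraph`). By weak density the coefficient commutes with all
bounded operators, so it is a scalar (`coeff_eq_smul`). These scalars are the matrix elements of an
operator `W` with `V (x ⊗ w) = x ⊗ W w`, and the same argument for `V†` makes `W` onto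
(`exists_eq_idTensor`). Phrasing commutation through graphs avoids domain bookkeeping for unbounded
`G k`. -/

namespace QDescriptor

universe u v w

/-! ### Bounded operators commuting with unbounded generators -/

section Commutant

variable {X : Type u} [NormedAddCommGroup X] [InnerProductSpace ℂ X]

/-- The bounded operator `A` commutes with `T`, in the sense that `A T ⊆ T A`. -/
def PreservesGraph (A : X →L[ℂ] X) (T : X →ₗ.[ℂ] X) : Prop :=
  ∀ x y, (x, y) ∈ T.graph → (A x, A y) ∈ T.graph

theorem mem_graph_iff_exists (T : X →ₗ.[ℂ] X) (x y : X) :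
    (x, y) ∈ T.graph ↔ ∃ h : x ∈ T.domain, T ⟨x, h⟩ = y := by
  simp [LinearPMap.mem_graph_iff]

/-- Viewed as relations, products compose with no condition on domains left to check; the sum and
scalar multiple below are treated likewise. -/
theorem mem_graph_opMul (S T : X →ₗ.[ℂ] X) (x z : X) :
    (x, z) ∈ (opMul S T).graph ↔ ∃ y, (x, y) ∈ T.graph ∧ (y, z) ∈ S.graph := by
  simp only [mem_graph_iff_exists]
  constructor
  · rintro ⟨h, rfl⟩
    obtain ⟨h1, h2⟩ := (mem_opMul_domain S T x).1 h
    exact ⟨T ⟨x, h1⟩, ⟨h1, rfl⟩, h2, (opMul_apply S T x h1 h2).symm⟩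
  · rintro ⟨_, ⟨h1, rfl⟩, h2, rfl⟩
    exact ⟨(mem_opMul_domain S T x).2 ⟨h1, h2⟩, opMul_apply S T x h1 h2⟩

theorem mem_graph_add (S T : X →ₗ.[ℂ] X) (x z : X) :
    (x, z) ∈ (S + T).graph ↔ ∃ y y', (x, y) ∈ S.graph ∧ (x, y') ∈ T.graph ∧ y + y' = z := by
  simp only [mem_graph_iff_exists]
  constructor
  · rintro ⟨h, rfl⟩
    exact ⟨S ⟨x, h.1⟩, T ⟨x, h.2⟩, ⟨h.1, rfl⟩, ⟨h.2, rfl⟩, rfl⟩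
  · rintro ⟨_, _, ⟨h1, rfl⟩, ⟨h2, rfl⟩, rfl⟩
    exact ⟨⟨h1, h2⟩, rfl⟩

theorem mem_graph_smul (c : ℂ) (T : X →ₗ.[ℂ] X) (x z : X) :
    (x, z) ∈ (c • T).graph ↔ ∃ y, (x, y) ∈ T.graph ∧ c • y = z := by
  simp only [mem_graph_iff_exists]
  constructor
  · rintro ⟨h, rfl⟩
    exact ⟨T ⟨x, h⟩, ⟨h, rfl⟩, rfl⟩
  · rintro ⟨_, ⟨h, rfl⟩, rfl⟩
    exact ⟨h, rfl⟩

/-- An operator that commutes with all members of a WOT-dense set is a scalar. -/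
theorem eq_inner_smul_of_commute {s : Set (X →WOT[ℂ] X)} (hs : Dense s) {A A' : X →L[ℂ] X}
    (hAA' : ∀ x y, ⟪A' x, y⟫_ℂ = ⟪x, A y⟫_ℂ) (hA : ∀ B ∈ s, ∀ x, A (B x) = B (A x))
    {e : X} (he : ‖e‖ = 1) (x : X) : A x = ⟪e, A e⟫_ℂ • x := by
  have comm : ∀ (B : X →WOT[ℂ] X) (x : X), A (B x) = B (A x) := by
    intro B x
    refine ext_inner_left ℂ fun y => ?_
    -- With `A` moved to the left as `A'`, both sides are matrix coefficients of `B`, hence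
    -- continuous in the weak operator topology.
    have hc : IsClosed {B : X →WOT[ℂ] X | ⟪A' y, B x⟫_ℂ = ⟪y, B (A x)⟫_ℂ} :=
      isClosed_eq (ContinuousLinearMapWOT.continuous_dual_apply x (innerSL ℂ (A' y)))
        (ContinuousLinearMapWOT.continuous_dual_apply (A x) (innerSL ℂ y))
    rw [← hAA']
    refine closure_minimal (fun B hB => ?_) hc (hs B)
    change ⟪A' y, B x⟫_ℂ = ⟪y, B (A x)⟫_ℂ
    rw [hAA', hA B hB]
  -- The rank-one operator `|x⟩⟨e|` sends `e` to `x` and `A e` to `⟪e, A e⟫ x`.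
  have := comm (.ofCLM ((innerSL ℂ e).smulRight x)) e
  simpa [he] using this

variable [CompleteSpace X]

/-- If `A` and its adjoint `A'` commute with all generators, then they commute with every operator
generated from them by adjoints, products, linear combinations and closures. -/
theorem Generated.preservesGraph {κ : Type w} {G : κ → X →ₗ.[ℂ] X} {A A' : X →L[ℂ] X}
    (hAA' : ∀ x y, ⟪A' x, y⟫_ℂ = ⟪x, A y⟫_ℂ) (hA : ∀ k, PreservesGraph A (G k))
    (hA' : ∀ k, PreservesGraph A' (G k)) {T : X →ₗ.[ℂ] X} (hT : Generated G T) :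
    PreservesGraph A T ∧ PreservesGraph A' T := by
  have hA'A : ∀ x y, ⟪A x, y⟫_ℂ = ⟪x, A' y⟫_ℂ := fun x y => by
    rw [← inner_conj_symm, ← hAA', inner_conj_symm]
  -- The graph of `T†` is tested against that of `T`, and moving `B` across the inner product puts
  -- `B'` on the test pair. Adjoints thus exchange `B` and `B'`, so the induction must carry both.
  have adj : ∀ {B B' : X →L[ℂ] X} (_ : ∀ x y, ⟪B' x, y⟫_ℂ = ⟪x, B y⟫_ℂ) {T : X →ₗ.[ℂ] X}
      (_ : Dense (T.domain : Set X)), PreservesGraph B' T → PreservesGraph B T† := by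
    intro B B' hB T hd h x y hxy
    rw [LinearPMap.adjoint_graph_eq_graph_adjoint hd, Submodule.mem_adjoint_iff] at hxy ⊢
    intro a b hab
    have := hxy _ _ (h a b hab)
    simpa only [hB] using this
  have mul : ∀ {B : X →L[ℂ] X} {S T : X →ₗ.[ℂ] X}, PreservesGraph B S → PreservesGraph B T →
      PreservesGraph B (opMul S T) := by
    intro B S T hS hT x z h
    obtain ⟨y, h1, h2⟩ := (mem_graph_opMul S T x z).1 h
    exact (mem_graph_opMul S T _ _).2 ⟨B y, hT _ _ h1, hS _ _ h2⟩
  have add : ∀ {B : X →L[ℂ] X} {S T : X →ₗ.[ℂ] X}, PreservesGraph B S → PreservesGraph B T →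
      PreservesGraph B (S + T) := by
    intro B S T hS hT x z h
    obtain ⟨y, y', h1, h2, rfl⟩ := (mem_graph_add S T x z).1 h
    exact (mem_graph_add S T _ _).2 ⟨B y, B y', hS _ _ h1, hT _ _ h2, (map_add B y y').symm⟩
  have smul : ∀ {B : X →L[ℂ] X} (c : ℂ) {T : X →ₗ.[ℂ] X}, PreservesGraph B T →
      PreservesGraph B (c • T) := by
    intro B c T hT x z h
    obtain ⟨y, h1, rfl⟩ := (mem_graph_smul c T x z).1 h
    exact (mem_graph_smul c T _ _).2 ⟨B y, hT _ _ h1, (map_smul B c y).symm⟩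
  have clos : ∀ {B : X →L[ℂ] X} {T : X →ₗ.[ℂ] X} (_ : T.IsClosable), PreservesGraph B T →
      PreservesGraph B T.closure := by
    intro B T hT h x y hxy
    rw [← hT.graph_closure_eq_closure_graph] at hxy ⊢
    exact map_mem_closure (f := B.prodMap B) (ContinuousLinearMap.continuous _) hxy
      fun p hp => h p.1 p.2 hp
  induction hT with
  | of k => exact ⟨hA k, hA' k⟩
  | adjoint T hd _ ih => exact ⟨adj hAA' hd ih.2, adj hA'A hd ih.1⟩
  | mul S T _ _ ihS ihT => exact ⟨mul ihS.1 ihT.1, mul ihS.2 ihT.2⟩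
  | add S T _ _ ihS ihT => exact ⟨add ihS.1 ihT.1, add ihS.2 ihT.2⟩
  | smul c T _ ih => exact ⟨smul c ih.1, smul c ih.2⟩
  | closure T hT _ ih => exact ⟨clos hT ih.1, clos hT ih.2⟩

end Commutant

/-! ### Unitaries on a tensor product commuting with `G k ⊗ 1` -/

section Bipartite

variable {E : Type v} {F : Type w} [NormedAddCommGroup E] [InnerProductSpace ℂ E]
  [NormedAddCommGroup F] [InnerProductSpace ℂ F]

/-- The map `x ↦ x ⊗ w`. -/
noncomputable def tmulRight (E : Type v) [NormedAddCommGroup E] [InnerProductSpace ℂ E] (w : F) :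
    E →L[ℂ] HTensor E F :=
  (Completion.toComplL (𝕜 := ℂ) (E := E ⊗[ℂ] F)).comp ((TensorProduct.mkL ℂ E F).flip w)

/-- The map `w ↦ x ⊗ w`. -/
noncomputable def tmulLeft (F : Type w) [NormedAddCommGroup F] [InnerProductSpace ℂ F] (x : E) :
    F →L[ℂ] HTensor E F :=
  (Completion.toComplL (𝕜 := ℂ) (E := E ⊗[ℂ] F)).comp (TensorProduct.mkL ℂ E F x)

theorem tmulLeft_apply (x : E) (w : F) :
    tmulLeft F x w = ((x ⊗ₜ[ℂ] w : E ⊗[ℂ] F) : HTensor E F) := rfl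

theorem inner_tmulLeft (x x' : E) (w w' : F) :
    ⟪tmulLeft F x w, tmulLeft F x' w'⟫_ℂ = ⟪x, x'⟫_ℂ * ⟪w, w'⟫_ℂ := by
  rw [tmulLeft_apply, tmulLeft_apply, Completion.inner_coe, TensorProduct.inner_tmul]

theorem norm_tmulLeft (x : E) (w : F) : ‖tmulLeft F x w‖ = ‖x‖ * ‖w‖ := by
  rw [tmulLeft_apply, Completion.norm_coe, TensorProduct.norm_tmul]

theorem HTensor.isometryEquiv_ext {V V' : HTensor E F ≃ₗᵢ[ℂ] HTensor E F}
    (h : ∀ x w, V (tmulLeft F x w) = V' (tmulLeft F x w)) : V = V' := by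
  refine LinearIsometryEquiv.ext fun z => ?_
  induction z using Completion.induction_on with
  | hp => exact isClosed_eq V.continuous V'.continuous
  | ih z =>
    induction z using TensorProduct.induction_on with
    | zero => rw [Completion.coe_zero, map_zero, map_zero]
    | tmul x w => exact h x w
    | add z w hz hw => rw [Completion.coe_add, map_add, map_add, hz, hw]

theorem HTensor.ext_inner_tmulLeft {z z' : HTensor E F}
    (h : ∀ x w, ⟪tmulLeft F x w, z⟫_ℂ = ⟪tmulLeft F x w, z'⟫_ℂ) : z = z' := by
  refine Completion.denseRange_coe.eq_of_inner_right ℂ fun w => ?_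
  induction w using TensorProduct.induction_on with
  | zero => rw [Completion.coe_zero, inner_zero_left, inner_zero_left]
  | tmul x w => exact h x w
  | add z w hz hw => rw [Completion.coe_add, inner_add_left, inner_add_left, hz, hw]

theorem idTensor_tmulLeft (W : F ≃ₗᵢ[ℂ] F) (x : E) (w : F) :
    idTensor W (tmulLeft F x w) = tmulLeft F x (W w) :=
  idTensor_tmul W x w

theorem idTensor_mul (W W' : F ≃ₗᵢ[ℂ] F) :
    (idTensor (W * W') : HTensor E F ≃ₗᵢ[ℂ] HTensor E F) = idTensor W * idTensor W' :=
  HTensor.isometryEquiv_ext fun x w => by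
    simp only [LinearIsometryEquiv.coe_mul, Function.comp_apply, idTensor_tmulLeft]

theorem idTensor_one : (idTensor (1 : F ≃ₗᵢ[ℂ] F) : HTensor E F ≃ₗᵢ[ℂ] HTensor E F) = 1 :=
  HTensor.isometryEquiv_ext fun x w => by
    rw [idTensor_tmulLeft]
    rfl

theorem tmulRight_mem_tensorIdGraph {T : E →ₗ.[ℂ] E} {x y : E} (h : (x, y) ∈ T.graph) (w : F) :
    (tmulRight E w x, tmulRight E w y) ∈ tensorIdGraph F T := by
  obtain ⟨hx, rfl⟩ := (mem_graph_iff_exists T x y).1 h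
  exact Submodule.le_topologicalClosure _ (Submodule.subset_span ⟨⟨x, hx⟩, w, rfl⟩)

/-- `1 ⊗ W` only replaces `y` by `W y` in a spanning pair `(x ⊗ y, T x ⊗ y)`; continuity extends
this to the closed span. -/
theorem idTensor_mem_tensorIdGraph (W : F ≃ₗᵢ[ℂ] F) {T : E →ₗ.[ℂ] E}
    {p : HTensor E F × HTensor E F} (hp : p ∈ tensorIdGraph F T) :
    (idTensor W p.1, idTensor W p.2) ∈ tensorIdGraph F T := by
  let L : HTensor E F →L[ℂ] HTensor E F := (idTensor W : HTensor E F ≃ₗᵢ[ℂ] HTensor E F)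
  refine map_mem_closure (f := L.prodMap L) (ContinuousLinearMap.continuous _) hp
    fun p hp => ?_
  change p ∈ Submodule.span ℂ _ at hp
  change p ∈ (Submodule.span ℂ _).comap (L.prodMap L).toLinearMap
  refine Submodule.span_le.2 ?_ hp
  rintro _ ⟨x, y, rfl⟩
  refine Submodule.subset_span ⟨x, W y, ?_⟩
  exact Prod.ext (idTensor_tmul W _ _) (idTensor_tmul W _ _)

theorem idTensor_mem_tensorIdGraph_iff (W : F ≃ₗᵢ[ℂ] F) {T : E →ₗ.[ℂ] E}
    {p : HTensor E F × HTensor E F} :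
    (idTensor W p.1, idTensor W p.2) ∈ tensorIdGraph F T ↔ p ∈ tensorIdGraph F T := by
  refine ⟨fun h => ?_, idTensor_mem_tensorIdGraph W⟩
  have cancel : ∀ z : HTensor E F, idTensor W⁻¹ (idTensor W z) = z := fun z => by
    rw [← Function.comp_apply (f := idTensor W⁻¹), ← LinearIsometryEquiv.coe_mul,
      ← idTensor_mul, inv_mul_cancel, idTensor_one, LinearIsometryEquiv.coe_one, id_eq]
  simpa only [cancel] using idTensor_mem_tensorIdGraph W⁻¹ h

variable [CompleteSpace E]

/-- The matrix coefficient `⟨v| V |w⟩` of `V` with respect to the second tensor factor. -/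
noncomputable def coeff (V : HTensor E F ≃ₗᵢ[ℂ] HTensor E F) (v w : F) : E →L[ℂ] E :=
  (slice v).comp ((V : HTensor E F →L[ℂ] HTensor E F).comp (tmulRight E w))

theorem inner_coeff (V : HTensor E F ≃ₗᵢ[ℂ] HTensor E F) (v w : F) (x y : E) :
    ⟪x, coeff V v w y⟫_ℂ = ⟪tmulLeft F x v, V (tmulLeft F y w)⟫_ℂ :=
  inner_slice v x _

/-- Since `V† = V⁻¹`, this identifies the adjoint of a coefficient as a coefficient of `V.symm`,
which satisfies the same commutation hypotheses. -/
theorem coeff_symm_inner (V : HTensor E F ≃ₗᵢ[ℂ] HTensor E F) (v w : F) (x y : E) :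
    ⟪coeff V.symm w v x, y⟫_ℂ = ⟪x, coeff V v w y⟫_ℂ := by
  rw [← inner_conj_symm, inner_coeff, inner_coeff, inner_conj_symm,
    ← V.inner_map_map, V.apply_symm_apply]

/-- Tensoring with `w` carries the graph of `T` into that of `T ⊗ 1`, `V` keeps it there, and
slicing with `v` returns to the graph of `T`. Only the last move needs `T` closed. -/
theorem coeff_preservesGraph {V : HTensor E F ≃ₗᵢ[ℂ] HTensor E F} {T : E →ₗ.[ℂ] E}
    (hT : T.IsClosed) (hV : ∀ p ∈ tensorIdGraph F T, (V p.1, V p.2) ∈ tensorIdGraph F T)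
    (v w : F) : PreservesGraph (coeff V v w) T := fun _ _ h =>
  slice_mem_graph hT v _ (hV _ (tmulRight_mem_tensorIdGraph h w))

/-- A unitary commuting with `G k ⊗ 1` for a generating family `G` has scalar coefficients. -/
theorem coeff_eq_smul {κ : Type*} {G : κ → E →ₗ.[ℂ] E} (hG : IsGenerating G)
    {V : HTensor E F ≃ₗᵢ[ℂ] HTensor E F}
    (hV : ∀ k, ∀ p, (V p.1, V p.2) ∈ tensorIdGraph F (G k) ↔ p ∈ tensorIdGraph F (G k))
    {e : E} (he : ‖e‖ = 1) (v w : F) (x : E) :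
    coeff V v w x = ⟪e, coeff V v w e⟫_ℂ • x := by
  have h1 : ∀ k, PreservesGraph (coeff V v w) (G k) := fun k =>
    coeff_preservesGraph (hG.isClosed k) (fun p hp => (hV k p).2 hp) v w
  have h2 : ∀ k, PreservesGraph (coeff V.symm w v) (G k) := fun k =>
    coeff_preservesGraph (hG.isClosed k) (fun p hp => (hV k _).1 (by simpa using hp)) w v
  refine eq_inner_smul_of_commute hG.dense_span (coeff_symm_inner V v w) (fun B hB y => ?_) he x
  -- As `B` is defined everywhere, preserving its graph is genuine commutation.
  have := (Generated.preservesGraph (coeff_symm_inner V v w) h1 h2 hB).1 y (B y)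
    ((mem_graph_iff_exists _ _ _).2 ⟨trivial, rfl⟩)
  obtain ⟨_, h⟩ := (mem_graph_iff_exists _ _ _).1 this
  exact h.symm

/-- The slice of `V` at the unit vector `e` satisfies `V (x ⊗ w) = x ⊗ W w`. -/
theorem exists_isometry_apply_tmulLeft [CompleteSpace F] {κ : Type*} {G : κ → E →ₗ.[ℂ] E}
    (hG : IsGenerating G) {V : HTensor E F ≃ₗᵢ[ℂ] HTensor E F}
    (hV : ∀ k, ∀ p, (V p.1, V p.2) ∈ tensorIdGraph F (G k) ↔ p ∈ tensorIdGraph F (G k))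
    {e : E} (he : ‖e‖ = 1) :
    ∃ W : F →ₗᵢ[ℂ] F, ∀ x w, V (tmulLeft F x w) = tmulLeft F x (W w) := by
  -- The compression of `V` to `e ⊗ F`; its matrix elements are the scalars `⟪e, ⟨v|V|w⟩ e⟫`.
  let W : F →L[ℂ] F := (ContinuousLinearMap.adjoint (tmulLeft F e)).comp
    ((V : HTensor E F →L[ℂ] HTensor E F).comp (tmulLeft F e))
  have hW : ∀ x w, V (tmulLeft F x w) = tmulLeft F x (W w) := by
    intro x w
    refine HTensor.ext_inner_tmulLeft fun a v => ?_
    have h1 : ⟪v, W w⟫_ℂ = ⟪e, coeff V v w e⟫_ℂ := by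
      rw [inner_coeff]
      exact ContinuousLinearMap.adjoint_inner_right (tmulLeft F e) v (V (tmulLeft F e w))
    rw [← inner_coeff, coeff_eq_smul hG hV he, inner_smul_right, inner_tmulLeft, h1, mul_comm]
  refine ⟨⟨W.toLinearMap, fun w => ?_⟩, hW⟩
  have := congrArg norm (hW e w)
  rw [V.norm_map, norm_tmulLeft, norm_tmulLeft, he, one_mul, one_mul] at this
  exact this.symm

/-- A unitary commuting with `G k ⊗ 1` for a generating family `G` is of the form `1 ⊗ W`. -/
theorem exists_eq_idTensor [CompleteSpace F] [Nontrivial E] {κ : Type*} {G : κ → E →ₗ.[ℂ] E}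
    (hG : IsGenerating G) {V : HTensor E F ≃ₗᵢ[ℂ] HTensor E F}
    (hV : ∀ k, ∀ p, (V p.1, V p.2) ∈ tensorIdGraph F (G k) ↔ p ∈ tensorIdGraph F (G k)) :
    ∃ W : F ≃ₗᵢ[ℂ] F, V = idTensor W := by
  obtain ⟨e, he⟩ : ∃ e : E, ‖e‖ = 1 :=
    let ⟨_, hx⟩ := exists_ne (0 : E)
    ⟨_, norm_smul_inv_norm (𝕜 := ℂ) hx⟩
  obtain ⟨W, hW⟩ := exists_isometry_apply_tmulLeft hG hV he
  obtain ⟨W', hW'⟩ := exists_isometry_apply_tmulLeft (V := V.symm) hG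
    (fun k p => by simpa using (hV k (V.symm p.1, V.symm p.2)).symm) he
  have inj : Function.Injective (tmulLeft F e) :=
    (injective_iff_map_eq_zero _).2 fun w hw => by
      simpa [norm_tmulLeft, he] using congrArg norm hw
  -- Applying `V` to `V† (e ⊗ w) = e ⊗ W' w` gives `e ⊗ w = e ⊗ W (W' w)`.
  have surj : Function.Surjective W := fun w => ⟨W' w, inj <| by
    rw [← hW, ← hW', V.apply_symm_apply]⟩
  refine ⟨LinearIsometryEquiv.ofSurjective W surj, HTensor.isometryEquiv_ext fun x w => ?_⟩
  rw [idTensor_tmulLeft, hW]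
  rfl

end Bipartite

/-! ### Graphs of conjugated operators -/

section Conjugation

variable {X : Type u} {Y : Type v} [NormedAddCommGroup X] [InnerProductSpace ℂ X]
  [NormedAddCommGroup Y] [InnerProductSpace ℂ Y]

theorem mem_graph_conjBy (U : X ≃ₗᵢ[ℂ] Y) (T : Y →ₗ.[ℂ] Y) (x y : X) :
    (x, y) ∈ (conjBy U T).graph ↔ (U x, U y) ∈ T.graph := by
  simp only [mem_graph_iff_exists]
  refine exists_congr fun h => ?_
  rw [conjBy_apply, LinearIsometryEquiv.symm_apply_eq]

end Conjugation

/-! ### Orbits and descriptors of a subsystem -/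

section System

variable {I : Type u} {H : I → Type v} [∀ i, NormedAddCommGroup (H i)]
  [∀ i, InnerProductSpace ℂ (H i)] (Ω : ∀ i, Metric.sphere (0 : H i) 1) (i : I)

theorem complAct_mul (W W' : Compl Ω i ≃ₗᵢ[ℂ] Compl Ω i) :
    complAct Ω i (W * W') = complAct Ω i W * complAct Ω i W' := by
  refine LinearIsometryEquiv.ext fun z => (split Ω i).injective ?_
  simp [complAct, idTensor_mul]

theorem complAct_one : complAct Ω i 1 = 1 := by
  refine LinearIsometryEquiv.ext fun z => (split Ω i).injective ?_
  simp [complAct, idTensor_one]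

theorem split_complAct (W : Compl Ω i ≃ₗᵢ[ℂ] Compl Ω i) (z : Tensor Ω) :
    split Ω i (complAct Ω i W z) = idTensor W (split Ω i z) := by
  simp [complAct]

/-- The operators `1 ⊗ W` form a group, so these sets are its orbits under left multiplication, and
two orbits agree once one contains a representative of the other. -/
theorem noumenal_eq_iff (U U' : Tensor Ω ≃ₗᵢ[ℂ] Tensor Ω) :
    noumenal Ω i U = noumenal Ω i U' ↔ ∃ W, U = complAct Ω i W * U' := by
  constructor
  · intro h
    have : U ∈ noumenal Ω i U := ⟨1, by rw [complAct_one, one_mul]⟩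
    rwa [h] at this
  · rintro ⟨W, rfl⟩
    ext V
    constructor
    · rintro ⟨W', rfl⟩
      exact ⟨W' * W, by rw [complAct_mul, mul_assoc]⟩
    · rintro ⟨W', rfl⟩
      refine ⟨W' * W⁻¹, ?_⟩
      rw [← mul_assoc, ← complAct_mul, inv_mul_cancel_right]

theorem mem_graph_descriptor [CompleteSpace (H i)] {κ : Type*} {G : κ → H i →ₗ.[ℂ] H i} {k : κ}
    (hG : (G k).IsClosed) (U : Tensor Ω ≃ₗᵢ[ℂ] Tensor Ω) (x y : Tensor Ω) :
    (x, y) ∈ (descriptor Ω i G U k).graph ↔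
      (split Ω i (U x), split Ω i (U y)) ∈ tensorIdGraph (Compl Ω i) (G k) := by
  rw [descriptor, mem_graph_conjBy, descriptorZero, mem_graph_conjBy, graph_tensorId hG]

end System

end QDescriptor

/-! ### The equivalence -/

theorem theorem1 {I : Type*} {H : I → Type*} [∀ i, NormedAddCommGroup (H i)]
    [∀ i, InnerProductSpace ℂ (H i)] [∀ i, CompleteSpace (H i)]
    (_hdim : ∀ i, 1 < Module.rank ℂ (H i))
    (Ω : ∀ i, Metric.sphere (0 : H i) 1) (i : I)
    {κ : Type*} (G : κ → H i →ₗ.[ℂ] H i) (hG : QDescriptor.IsGenerating G)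
    (U U' : QDescriptor.Tensor Ω ≃ₗᵢ[ℂ] QDescriptor.Tensor Ω) :
    QDescriptor.noumenal Ω i U = QDescriptor.noumenal Ω i U' ↔
      QDescriptor.descriptor Ω i G U = QDescriptor.descriptor Ω i G U' := by
  have : Nontrivial (H i) := rank_pos_iff_nontrivial.1 (zero_lt_one.trans (_hdim i))
  rw [QDescriptor.noumenal_eq_iff]
  constructor
  · rintro ⟨W, rfl⟩
    refine funext fun k => LinearPMap.eq_of_eq_graph (Submodule.ext fun ⟨x, y⟩ => ?_)
    rw [QDescriptor.mem_graph_descriptor Ω i (hG.isClosed k),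
      QDescriptor.mem_graph_descriptor Ω i (hG.isClosed k), LinearIsometryEquiv.coe_mul,
      Function.comp_apply, Function.comp_apply, QDescriptor.split_complAct, QDescriptor.split_complAct]
    exact QDescriptor.idTensor_mem_tensorIdGraph_iff W (p := (_, _))
  · intro h
    let S := QDescriptor.split Ω i
    -- `V = S U U'† S†`; since `S U'` is onto, every pair in the doubled space is `(S U' x, S U'
    -- y)`, and equality of descriptors then gives invariance of the graphs under `V`.
    let V := ((S.symm.trans U'.symm).trans U).trans S
    have hV : ∀ z, V (S (U' z)) = S (U z) := fun z => by simp [V]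
    obtain ⟨W, hW⟩ := QDescriptor.exists_eq_idTensor (V := V) hG fun k p => by
      obtain ⟨x, hx⟩ := (U'.trans S).surjective p.1
      obtain ⟨y, hy⟩ := (U'.trans S).surjective p.2
      have hp : p = (S (U' x), S (U' y)) := Prod.ext hx.symm hy.symm
      rw [hp, hV, hV, ← QDescriptor.mem_graph_descriptor Ω i (hG.isClosed k), h,
        QDescriptor.mem_graph_descriptor Ω i (hG.isClosed k)]
    refine ⟨W, LinearIsometryEquiv.ext fun z => S.injective ?_⟩
    rw [LinearIsometryEquiv.coe_mul, Function.comp_apply, QDescriptor.split_complAct, ← hW]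
    exact (hV z).symm
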